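/- For a real number $t$ and an integer $m\ge 1$ let $\pi(t;m,1)$ be the number of primes $p\le t$ with $p\equiv 1 \pmod m$, and let $\varphi$ be Euler's totient function. There are absolute constants $C>0$ and $0<\epsilon_0<1$ such that for every $\epsilon$ with $0<\epsilon<\epsilon_0$ there is $x_0=x_0(\epsilon)$ such that for all real $x\ge x_0$ $$\Bigg|\sum_{1\le m\leqslant x^{1-\epsilon}}\varphi(m)\int_{2}^{m^{1+\epsilon}}\frac{\pi(t;m,1)}{(t-1)^2}\,dt\int_{m^{1+\epsilon}}^{x}\frac{\pi(t;m,1)}{(t-1)^2}\,dt\Bigg|\leqslant C\Big(\epsilon(\log \epsilon^{-1})^2\log x+(\log\log x)^2\Big).$$ -/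

import Mathlib

/-- `primesMod t k a` is `π(t; k, a)`: the number of primes `p ≤ t` with `p ≡ a (mod k)`,
for a real number `t`. -/
noncomputable def primesMod (t : ℝ) (k a : ℕ) : ℕ :=
  ((Finset.Icc 1 ⌊t⌋₊).filter fun p => p.Prime ∧ p ≡ a [MOD k]).card

/-- The sum over the integers `1 ≤ m ≤ x ^ (1 - ε)` of
`φ(m) · ∫_2^{m^{1+ε}} π(t;m,1)/(t-1)² dt · ∫_{m^{1+ε}}^x π(t;m,1)/(t-1)² dt`. -/
noncomputable def crossSum (ε x : ℝ) : ℝ :=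
  ∑ m ∈ Finset.Icc 1 ⌊x ^ (1 - ε)⌋₊,
    (Nat.totient m : ℝ) *
      (∫ t in (2 : ℝ)..((m : ℝ) ^ (1 + ε)), (primesMod t m 1 : ℝ) / (t - 1) ^ 2) *
      (∫ t in ((m : ℝ) ^ (1 + ε))..x, (primesMod t m 1 : ℝ) / (t - 1) ^ 2)

/-!
The Selberg sieve gives the Brun–Titchmarsh bound `π(t; m, 1) ≪ (t / φ(m)) / log (t / m)`.
Integrated from `m ^ (1 + ε)` to `x`, it bounds `φ(m)` times the second integral by a constant
multiple of `log log (x / m) - log log (m ^ ε) ≤ log ε⁻¹ + log (log x / log m)`.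

By partial summation the first integral is at most the sum of `1 / (p - 1)` over the primes
`p = m * k + 1` with `k ≤ m ^ ε`. This is small only on average over `m`: for `m` in a dyadic block
`[2 ^ j, 2 ^ (j + 1))` and `k` fixed, the same `p` are primes in a progression modulo `k`, so
Brun–Titchmarsh applies again and, since `∑ k ≤ K, 1 / φ(k) ≪ 1 + log K`, the sum over the block is
`O(ε + 1 / j)`. The bound `log y ≤ 2 √y` with `y = log x / log m ≪ log x / j` then reduces the claim
to summing `(ε + 1 / j) * (log ε⁻¹ + √(log x / j))` over the `j ≪ log x`; the terms with `ε` give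
`O(ε * (1 + log ε⁻¹) * log x)` and those with `1 / j` are `o(log x)`.
-/

open Finset MeasureTheory
open scoped ArithmeticFunction.Moebius

/-! ### The Selberg upper bound sieve -/

section SelbergSieve

open BoundingSieve

theorem sum_divisors_moebius (n : ℕ) : ∑ d ∈ n.divisors, (μ d : ℝ) = if n = 1 then 1 else 0 := by
  rw [← ArithmeticFunction.one_apply, ← ArithmeticFunction.coe_moebius_mul_coe_zeta,
    ArithmeticFunction.coe_mul_zeta_apply]
  rfl

theorem filter_dvd_divisors_mul {l : ℕ} (hl : 0 < l) (n : ℕ) :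
    {d ∈ (l * n).divisors | l ∣ d} = n.divisors.image (l * ·) := by
  ext d
  simp only [mem_filter, Nat.mem_divisors, mem_image]
  constructor
  · rintro ⟨⟨hd, hln⟩, c, rfl⟩
    exact ⟨c, ⟨Nat.dvd_of_mul_dvd_mul_left hl hd, right_ne_zero_of_mul hln⟩, rfl⟩
  · rintro ⟨c, ⟨hc, hn⟩, rfl⟩
    exact ⟨⟨Nat.mul_dvd_mul_left l hc, mul_ne_zero hl.ne' hn⟩, dvd_mul_right l c⟩

theorem sum_moebius_divisors_filter_dvd {l n : ℕ} (hn : Squarefree n) :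
    ∑ d ∈ n.divisors with l ∣ d, (μ d : ℝ) = if n = l then (μ l : ℝ) else 0 := by
  by_cases hln : l ∣ n
  · obtain ⟨f, rfl⟩ := hln
    have hl : 0 < l := Nat.pos_of_ne_zero (left_ne_zero_of_mul hn.ne_zero)
    have hlf : l.Coprime f := (Nat.squarefree_mul_iff.1 hn).1
    have moebius_mul : ∀ c ∈ f.divisors, (μ (l * c) : ℝ) = μ l * μ c := fun c hc => by
      rw [ArithmeticFunction.isMultiplicative_moebius.map_mul_of_coprime
        (hlf.coprime_dvd_right (Nat.dvd_of_mem_divisors hc)), Int.cast_mul]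
    rw [filter_dvd_divisors_mul hl, sum_image fun a _ b _ => Nat.eq_of_mul_eq_mul_left hl,
      sum_congr rfl moebius_mul, ← mul_sum, sum_divisors_moebius]
    simp [hl.ne']
  · rw [if_neg (by rintro rfl; exact hln dvd_rfl), filter_false_of_mem, sum_empty]
    exact fun d hd hld => hln (hld.trans (Nat.dvd_of_mem_divisors hd))

theorem sum_divisors_lambdaSquared (w : ℕ → ℝ) (n : ℕ) :
    ∑ d ∈ n.divisors, lambdaSquared w d = (∑ d ∈ n.divisors, w d) ^ 2 := by
  have lcm_mem : ∀ p ∈ n.divisors ×ˢ n.divisors, p.1.lcm p.2 ∈ n.divisors := by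
    simp +contextual [Nat.lcm_dvd_iff]
  rw [sq, sum_mul_sum, ← sum_product', ← sum_fiberwise_of_maps_to lcm_mem]
  refine sum_congr rfl fun d hd => ?_
  have pairs_eq : {p ∈ n.divisors ×ˢ n.divisors | p.1.lcm p.2 = d} =
      {p ∈ d.divisors ×ˢ d.divisors | d = p.1.lcm p.2} := by
    obtain ⟨hdn, hn⟩ := Nat.mem_divisors.1 hd
    ext ⟨a, b⟩
    simp only [mem_filter, mem_product, Nat.mem_divisors]
    constructor
    · rintro ⟨-, rfl⟩
      have h0 := ne_zero_of_dvd_ne_zero hn hdn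
      exact ⟨⟨⟨Nat.dvd_lcm_left a b, h0⟩, Nat.dvd_lcm_right a b, h0⟩, rfl⟩
    · rintro ⟨⟨⟨ha, -⟩, hb, -⟩, rfl⟩
      exact ⟨⟨⟨ha.trans hdn, hn⟩, hb.trans hdn, hn⟩, rfl⟩
  rw [lambdaSquared, pairs_eq, sum_filter, sum_product]

theorem abs_lambdaSquared_le (w : ℕ → ℝ) (d : ℕ) :
    |lambdaSquared w d| ≤ lambdaSquared (fun n => |w n|) d := by
  refine (abs_sum_le_sum_abs _ _).trans (sum_le_sum fun d₁ _ => ?_)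
  refine (abs_sum_le_sum_abs _ _).trans (sum_le_sum fun d₂ _ => ?_)
  split_ifs
  · rw [abs_mul]
  · rw [abs_zero]

/-- The divisors at most `Z` of the sifting product, which index the Selberg sieve of level
`Z ^ 2`. -/
def selbergSupport (s : BoundingSieve) (Z : ℕ) : Finset ℕ :=
  {l ∈ s.prodPrimes.divisors | l ≤ Z}

/-- The quantity usually written `S` or `G(Z)`, by which the Selberg sieve divides the total
mass. -/
noncomputable def selbergSum (s : BoundingSieve) (Z : ℕ) : ℝ :=
  ∑ l ∈ selbergSupport s Z, s.selbergTerms l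

/-- The weights `ρ_d` which minimise the quadratic form of the Selberg sieve subject to
`ρ_1 = 1` and `ρ_d = 0` for `d > Z`. -/
noncomputable def selbergWeights (s : BoundingSieve) (Z d : ℕ) : ℝ :=
  (s.nu d)⁻¹ * (μ d * (∑ l ∈ selbergSupport s Z with d ∣ l, s.selbergTerms l) / selbergSum s Z)

variable {s : BoundingSieve} {Z : ℕ}

theorem mem_selbergSupport {l : ℕ} : l ∈ selbergSupport s Z ↔ l ∣ s.prodPrimes ∧ l ≤ Z := by
  simp [selbergSupport, prodPrimes_ne_zero]

theorem selbergTerms_pos_of_mem {l : ℕ} (hl : l ∈ selbergSupport s Z) : 0 < s.selbergTerms l :=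
  selbergTerms_pos (mem_selbergSupport.1 hl).1

theorem selbergSum_pos (hZ : 1 ≤ Z) : 0 < selbergSum s Z :=
  sum_pos (fun _ => selbergTerms_pos_of_mem) ⟨1, mem_selbergSupport.2 ⟨one_dvd _, hZ⟩⟩

theorem selbergWeights_one (hZ : 1 ≤ Z) : selbergWeights s Z 1 = 1 := by
  have hS := (selbergSum_pos (s := s) hZ).ne'
  simp only [selbergWeights, s.nu_mult.map_one, inv_one, ArithmeticFunction.moebius_apply_one,
    Int.cast_one, one_mul, one_dvd, filter_true]
  exact div_self hS

theorem selbergWeights_eq_zero {d : ℕ} (hd : Z < d) : selbergWeights s Z d = 0 := by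
  have no_multiple : ∀ l ∈ selbergSupport s Z, ¬d ∣ l := fun l hl hdl => by
    obtain ⟨hlP, hlZ⟩ := mem_selbergSupport.1 hl
    have := Nat.le_of_dvd (Nat.pos_of_dvd_of_pos hlP (Nat.pos_of_ne_zero prodPrimes_ne_zero)) hdl
    omega
  rw [selbergWeights, filter_false_of_mem no_multiple, sum_empty, mul_zero, zero_div, mul_zero]

theorem abs_selbergWeights_le {d : ℕ} (hZ : 1 ≤ Z) (hd : d ∣ s.prodPrimes) :
    |selbergWeights s Z d| ≤ (s.nu d)⁻¹ := by
  have hS := selbergSum_pos (s := s) hZ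
  have hν := inv_pos.2 (nu_pos_of_dvd_prodPrimes hd)
  have hμ : |(μ d : ℝ)| ≤ 1 := by exact_mod_cast ArithmeticFunction.abs_moebius_le_one
  have partial_nonneg : 0 ≤ ∑ l ∈ selbergSupport s Z with d ∣ l, s.selbergTerms l :=
    sum_nonneg fun l hl => (selbergTerms_pos_of_mem (mem_filter.1 hl).1).le
  have partial_le : ∑ l ∈ selbergSupport s Z with d ∣ l, s.selbergTerms l ≤ selbergSum s Z :=
    sum_le_sum_of_subset_of_nonneg (filter_subset _ _) fun l hl _ =>
      (selbergTerms_pos_of_mem hl).le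
  rw [selbergWeights, abs_mul, abs_of_pos hν, abs_div, abs_mul, abs_of_pos hS,
    abs_of_nonneg partial_nonneg]
  refine mul_le_of_le_one_right hν.le ((div_le_one hS).2 ?_)
  exact (mul_le_of_le_one_left partial_nonneg hμ).trans partial_le

theorem sum_nu_mul_selbergWeights (s : BoundingSieve) (Z l : ℕ) :
    ∑ d ∈ s.prodPrimes.divisors with l ∣ d, s.nu d * selbergWeights s Z d =
      if l ∈ selbergSupport s Z then μ l * s.selbergTerms l / selbergSum s Z else 0 := by
  have expand : ∀ d ∈ s.prodPrimes.divisors.filter (l ∣ ·), s.nu d * selbergWeights s Z d =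
      ∑ e ∈ selbergSupport s Z with d ∣ e, μ d * (s.selbergTerms e / selbergSum s Z) := by
    intro d hd
    have hν := nu_ne_zero (Nat.dvd_of_mem_divisors (mem_filter.1 hd).1)
    rw [selbergWeights, mul_inv_cancel_left₀ hν, mul_div_assoc, sum_div, mul_sum]
  calc ∑ d ∈ s.prodPrimes.divisors with l ∣ d, s.nu d * selbergWeights s Z d
    _ = ∑ e ∈ selbergSupport s Z, ∑ d ∈ e.divisors with l ∣ d,
          μ d * (s.selbergTerms e / selbergSum s Z) := by
        rw [sum_congr rfl expand]
        refine sum_comm' fun d e => ?_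
        simp only [mem_filter, Nat.mem_divisors, mem_selbergSupport]
        constructor
        · rintro ⟨⟨⟨-, hP⟩, hld⟩, ⟨heP, heZ⟩, hde⟩
          exact ⟨⟨⟨hde, ne_zero_of_dvd_ne_zero hP heP⟩, hld⟩, heP, heZ⟩
        · rintro ⟨⟨⟨hde, -⟩, hld⟩, heP, heZ⟩
          exact ⟨⟨⟨hde.trans heP, prodPrimes_ne_zero⟩, hld⟩, ⟨heP, heZ⟩, hde⟩
    _ = ∑ e ∈ selbergSupport s Z,
          if e = l then μ l * (s.selbergTerms l / selbergSum s Z) else 0 := by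
        refine sum_congr rfl fun e he => ?_
        rw [← sum_mul, sum_moebius_divisors_filter_dvd
          (squarefree_of_dvd_prodPrimes (mem_selbergSupport.1 he).1), ite_mul, zero_mul]
        split_ifs with h
        · rw [h]
        · rfl
    _ = _ := by rw [sum_ite_eq', mul_div_assoc]

theorem mainSum_selbergWeights (hZ : 1 ≤ Z) :
    s.mainSum (lambdaSquared (selbergWeights s Z)) = (selbergSum s Z)⁻¹ := by
  have hS := (selbergSum_pos (s := s) hZ).ne'
  have diagonal : ∀ l ∈ s.prodPrimes.divisors, (s.selbergTerms l)⁻¹ *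
      (∑ d ∈ s.prodPrimes.divisors with l ∣ d, s.nu d * selbergWeights s Z d) ^ 2 =
      if l ≤ Z then s.selbergTerms l / selbergSum s Z ^ 2 else 0 := by
    intro l hl
    have hlP := Nat.dvd_of_mem_divisors hl
    have hg := (selbergTerms_pos hlP).ne'
    simp only [sum_nu_mul_selbergWeights, mem_selbergSupport, hlP, true_and]
    split_ifs
    · have hμ : (μ l : ℝ) ^ 2 = 1 := by
        exact_mod_cast ArithmeticFunction.moebius_sq_eq_one_of_squarefree
          (squarefree_of_dvd_prodPrimes hlP)
      rw [div_pow, mul_pow, hμ]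
      field_simp
    · simp
  rw [mainSum_lambdaSquared_eq_sum_mul_sum_sq]
  simp only [← sum_filter]
  rw [sum_congr rfl diagonal, ← sum_filter, ← sum_div]
  change selbergSum s Z / _ = _
  field_simp

theorem errSum_lambdaSquared_le (w : ℕ → ℝ) {B : ℝ}
    (hrem : ∀ d, d ∣ s.prodPrimes → |s.rem d| ≤ B) :
    s.errSum (lambdaSquared w) ≤ B * (∑ d ∈ s.prodPrimes.divisors, |w d|) ^ 2 := by
  rw [← sum_divisors_lambdaSquared, mul_sum]
  refine sum_le_sum fun d hd => ?_
  rw [mul_comm B]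
  exact mul_le_mul (abs_lambdaSquared_le w d) (hrem d (Nat.dvd_of_mem_divisors hd))
    (abs_nonneg _) ((abs_nonneg _).trans (abs_lambdaSquared_le w d))

theorem siftedSum_le_selberg {B : ℝ} (hZ : 1 ≤ Z)
    (hrem : ∀ d, d ∣ s.prodPrimes → |s.rem d| ≤ B) :
    s.siftedSum ≤ s.totalMass / selbergSum s Z +
      B * (∑ d ∈ selbergSupport s Z, (s.nu d)⁻¹) ^ 2 := by
  have hB : 0 ≤ B := (abs_nonneg _).trans (hrem 1 (one_dvd _))
  have weights_le : ∀ d ∈ s.prodPrimes.divisors,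
      |selbergWeights s Z d| ≤ if d ≤ Z then (s.nu d)⁻¹ else 0 := by
    intro d hd
    split_ifs with hdZ
    · exact abs_selbergWeights_le hZ (Nat.dvd_of_mem_divisors hd)
    · rw [selbergWeights_eq_zero (not_le.1 hdZ), abs_zero]
  calc s.siftedSum
    _ ≤ s.totalMass * s.mainSum (lambdaSquared (selbergWeights s Z)) +
          s.errSum (lambdaSquared (selbergWeights s Z)) :=
        siftedSum_le_mainSum_errSum_of_upperMoebius _
          (upperMoebius_lambdaSquared _ (selbergWeights_one hZ))
    _ ≤ s.totalMass / selbergSum s Z +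
          B * (∑ d ∈ s.prodPrimes.divisors, |selbergWeights s Z d|) ^ 2 := by
        rw [mainSum_selbergWeights hZ, ← div_eq_mul_inv]
        gcongr
        exact errSum_lambdaSquared_le _ hrem
    _ ≤ _ := by
        rw [selbergSupport, sum_filter]
        gcongr with d hd
        exact weights_le d hd

end SelbergSieve

/-! ### Sums of reciprocals of integers and of totients -/

section Totient

theorem log_add_one_le_sum_inv (n : ℕ) : Real.log (n + 1) ≤ ∑ k ∈ Icc 1 n, (k : ℝ)⁻¹ := by
  simpa [harmonic_eq_sum_Icc] using log_add_one_le_harmonic n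

theorem sum_inv_le_one_add_log (n : ℕ) : ∑ k ∈ Icc 1 n, (k : ℝ)⁻¹ ≤ 1 + Real.log n := by
  simpa [harmonic_eq_sum_Icc] using harmonic_le_one_add_log n

theorem prod_primeFactors_one_sub_inv {k : ℕ} (hk : k ≠ 0) :
    ∏ p ∈ k.primeFactors, (1 - (p : ℝ)⁻¹) = k.totient / k := by
  have h := congrArg (Rat.cast : ℚ → ℝ) (Nat.totient_eq_mul_prod_factors k)
  push_cast at h
  rw [h, mul_div_cancel_left₀ _ (Nat.cast_ne_zero.2 hk)]

theorem hasSum_inv_factoredNumbers_primeFactors {k : ℕ} (hk : k ≠ 0) :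
    HasSum (fun n : Nat.factoredNumbers k.primeFactors => ((n : ℕ) : ℝ)⁻¹)
      (k / k.totient) := by
  let inv : ℕ →* ℝ :=
    { toFun := fun n => (n : ℝ)⁻¹
      map_one' := by simp
      map_mul' := fun a b => by simp [mul_comm] }
  have norm_inv_lt_one : ∀ {p : ℕ}, p.Prime → ‖inv p‖ < 1 := fun {p} hp => by
    change ‖(p : ℝ)⁻¹‖ < 1
    rw [norm_inv, RCLike.norm_natCast]
    exact inv_lt_one_of_one_lt₀ (by exact_mod_cast hp.one_lt)
  have h := (EulerProduct.summable_and_hasSum_factoredNumbers_prod_filter_prime_geometric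
    norm_inv_lt_one k.primeFactors).2
  rw [filter_true_of_mem fun p => Nat.prime_of_mem_primeFactors, prod_inv_distrib] at h
  have hprod : ∏ p ∈ k.primeFactors, (1 - inv p) = k.totient / k :=
    prod_primeFactors_one_sub_inv hk
  rwa [hprod, inv_div] at h

theorem sum_inv_le_div_totient {k : ℕ} (hk : k ≠ 0) {A : Finset ℕ}
    (hA : ∀ n ∈ A, n ∈ Nat.factoredNumbers k.primeFactors) :
    ∑ n ∈ A, (n : ℝ)⁻¹ ≤ k / k.totient := by
  have h := (hasSum_subtype_iff_indicator (f := fun n : ℕ => (n : ℝ)⁻¹)).1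
    (hasSum_inv_factoredNumbers_primeFactors hk)
  rw [← sum_congr rfl fun n hn => Set.indicator_of_mem (hA n hn) fun n : ℕ => (n : ℝ)⁻¹]
  exact sum_le_hasSum A (fun n _ => Set.indicator_nonneg (fun _ _ => by positivity) n) h

/-- The product of the primes dividing `n` but not `m`. -/
def coprimeRadical (m n : ℕ) : ℕ := ∏ p ∈ n.primeFactors \ m.primeFactors, p

theorem primeFactors_coprimeRadical (m n : ℕ) :
    (coprimeRadical m n).primeFactors = n.primeFactors \ m.primeFactors :=
  Nat.primeFactors_prod fun _ hp => Nat.prime_of_mem_primeFactors (mem_sdiff.1 hp).1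

theorem coprimeRadical_dvd (m n : ℕ) : coprimeRadical m n ∣ n :=
  (prod_dvd_prod_of_subset _ _ _ sdiff_subset).trans (Nat.prod_primeFactors_dvd n)

theorem squarefree_coprimeRadical (m n : ℕ) : Squarefree (coprimeRadical m n) := by
  have prime_of_mem : ∀ p ∈ n.primeFactors \ m.primeFactors, p.Prime := fun p hp =>
    Nat.prime_of_mem_primeFactors (mem_sdiff.1 hp).1
  refine Finset.squarefree_prod_of_pairwise_isCoprime (fun p hp q hq hpq => ?_)
    fun p hp => (prime_of_mem p hp).prime.squarefree
  exact Nat.coprime_iff_isRelPrime.1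
    ((Nat.coprime_primes (prime_of_mem p hp) (prime_of_mem q hq)).2 hpq)

theorem coprimeRadical_coprime {m : ℕ} (hm : m ≠ 0) (n : ℕ) : (coprimeRadical m n).Coprime m := by
  rw [← Nat.disjoint_primeFactors (squarefree_coprimeRadical m n).ne_zero hm,
    primeFactors_coprimeRadical]
  exact sdiff_disjoint

theorem sum_inv_filter_coprimeRadical_le {m l : ℕ} (hm : m ≠ 0) (hl : l ≠ 0)
    (hlm : l.Coprime m) (Z : ℕ) :
    ∑ n ∈ Icc 1 Z with coprimeRadical m n = l, (n : ℝ)⁻¹ ≤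
      m / m.totient * (l.totient : ℝ)⁻¹ := by
  set F : Finset ℕ := {n ∈ Icc 1 Z | coprimeRadical m n = l}
  have dvd_of_mem : ∀ n ∈ F, l ∣ n := fun n hn => (mem_filter.1 hn).2 ▸ coprimeRadical_dvd m n
  have cofactor_mem : ∀ b ∈ F.image (· / l), b ∈ Nat.factoredNumbers (l * m).primeFactors := by
    intro b hb
    obtain ⟨n, hn, rfl⟩ := mem_image.1 hb
    obtain ⟨hnZ, hnl⟩ := mem_filter.1 hn
    have hn0 : 0 < n := (mem_Icc.1 hnZ).1
    have hb0 : n / l ≠ 0 :=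
      (Nat.div_pos (Nat.le_of_dvd hn0 (dvd_of_mem n hn)) (Nat.pos_of_ne_zero hl)).ne'
    refine Nat.mem_factoredNumbers_of_primeFactors_subset hb0 fun p hp => ?_
    have hpn := Nat.primeFactors_mono (Nat.div_dvd_of_dvd (dvd_of_mem n hn)) hn0.ne' hp
    rw [Nat.primeFactors_mul hl hm, mem_union, ← hnl, primeFactors_coprimeRadical, mem_sdiff]
    tauto
  have div_injOn : Set.InjOn (· / l) (F : Set ℕ) := fun a ha b hb =>
    (Nat.div_left_inj (dvd_of_mem a ha) (dvd_of_mem b hb)).1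
  have factor_out : ∀ n ∈ F, (n : ℝ)⁻¹ = (l : ℝ)⁻¹ * ((n / l : ℕ) : ℝ)⁻¹ := fun n hn => by
    rw [← mul_inv, ← Nat.cast_mul, Nat.mul_div_cancel' (dvd_of_mem n hn)]
  calc ∑ n ∈ F, (n : ℝ)⁻¹
    _ = (l : ℝ)⁻¹ * ∑ b ∈ F.image (· / l), (b : ℝ)⁻¹ := by
        rw [sum_image div_injOn, mul_sum, sum_congr rfl factor_out]
    _ ≤ (l : ℝ)⁻¹ * ((l * m : ℕ) / (l * m).totient) := by
        gcongr
        exact sum_inv_le_div_totient (mul_ne_zero hl hm) cofactor_mem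
    _ = m / m.totient * (l.totient : ℝ)⁻¹ := by
        rw [Nat.totient_mul hlm]
        push_cast
        field_simp

theorem sum_inv_le_div_totient_mul_sum_inv_totient {m : ℕ} (hm : m ≠ 0) (Z : ℕ) :
    ∑ n ∈ Icc 1 Z, (n : ℝ)⁻¹ ≤
      m / m.totient * ∑ l ∈ Icc 1 Z with Squarefree l ∧ l.Coprime m, (l.totient : ℝ)⁻¹ := by
  have coprimeRadical_mem : ∀ n ∈ Icc 1 Z,
      coprimeRadical m n ∈ {l ∈ Icc 1 Z | Squarefree l ∧ l.Coprime m} := by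
    intro n hn
    obtain ⟨hn1, hnZ⟩ := mem_Icc.1 hn
    have hsq := squarefree_coprimeRadical m n
    exact mem_filter.2 ⟨mem_Icc.2 ⟨Nat.pos_of_ne_zero hsq.ne_zero,
      (Nat.le_of_dvd hn1 (coprimeRadical_dvd m n)).trans hnZ⟩, hsq, coprimeRadical_coprime hm n⟩
  rw [← sum_fiberwise_of_maps_to coprimeRadical_mem, mul_sum]
  refine sum_le_sum fun l hl => ?_
  obtain ⟨-, hsq, hlm⟩ := mem_filter.1 hl
  exact sum_inv_filter_coprimeRadical_le hm hsq.ne_zero hlm Z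

theorem half_le_prod_one_sub_inv_sq (K : ℕ) :
    (1 / 2 : ℝ) ≤ ∏ n ∈ Icc 2 K, (1 - ((n : ℝ) ^ 2)⁻¹) := by
  have telescope : ∀ K : ℕ,
      ∏ n ∈ Icc 2 (K + 1), (1 - ((n : ℝ) ^ 2)⁻¹) = (K + 2) / (2 * (K + 1)) := by
    intro K
    induction K with
    | zero => simp
    | succ K ih =>
      rw [prod_Icc_succ_top (by omega), ih]
      push_cast
      field_simp
      ring
  rcases K with _ | K
  · norm_num
  · rw [telescope, div_le_div_iff₀ (by norm_num) (by positivity)]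
    linarith

theorem half_le_prod_primeFactors_one_sub_inv_sq (k : ℕ) :
    (1 / 2 : ℝ) ≤ ∏ p ∈ k.primeFactors, (1 - ((p : ℝ) ^ 2)⁻¹) := by
  refine (half_le_prod_one_sub_inv_sq k).trans
    (prod_le_prod_of_subset_of_le_one (fun p hp => ?_) (fun n hn => ?_) fun n _ _ => ?_)
  · exact mem_Icc.2 ⟨(Nat.prime_of_mem_primeFactors hp).two_le, Nat.le_of_mem_primeFactors hp⟩
  · have hn1 : (1 : ℝ) ≤ n := by exact_mod_cast one_le_two.trans (mem_Icc.1 hn).1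
    exact sub_nonneg.2 (inv_le_one_of_one_le₀ (one_le_pow₀ hn1))
  · exact sub_le_self _ (by positivity)

theorem prod_primeFactors_one_add_inv_le {k : ℕ} (hk : k ≠ 0) :
    ∏ p ∈ k.primeFactors, (1 + (p : ℝ)⁻¹) ≤ ∑ d ∈ k.divisors, (d : ℝ)⁻¹ := by
  have primeFactors_prod : ∀ t ∈ k.primeFactors.powerset, (∏ p ∈ t, p).primeFactors = t :=
    fun t ht => Nat.primeFactors_prod fun p hp =>
      Nat.prime_of_mem_primeFactors (mem_powerset.1 ht hp)
  have prod_injOn : Set.InjOn (fun t : Finset ℕ => ∏ p ∈ t, p) k.primeFactors.powerset :=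
    fun a ha b hb hab => by
      rw [← primeFactors_prod a ha, ← primeFactors_prod b hb]
      exact congrArg Nat.primeFactors hab
  calc ∏ p ∈ k.primeFactors, (1 + (p : ℝ)⁻¹)
    _ = ∑ d ∈ k.primeFactors.powerset.image fun t => ∏ p ∈ t, p, (d : ℝ)⁻¹ := by
        rw [prod_one_add, sum_image prod_injOn]
        simp only [prod_inv_distrib, Nat.cast_prod]
    _ ≤ ∑ d ∈ k.divisors, (d : ℝ)⁻¹ := by
        refine sum_le_sum_of_subset_of_nonneg (fun d hd => ?_) fun _ _ _ => by positivity
        obtain ⟨t, ht, rfl⟩ := mem_image.1 hd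
        exact Nat.mem_divisors.2 ⟨(prod_dvd_prod_of_subset _ _ _ (mem_powerset.1 ht)).trans
          (Nat.prod_primeFactors_dvd k), hk⟩

theorem div_totient_le_two_mul_sum_divisors_inv {k : ℕ} (hk : k ≠ 0) :
    (k / k.totient : ℝ) ≤ 2 * ∑ d ∈ k.divisors, (d : ℝ)⁻¹ := by
  have hφ : (0 : ℝ) < k.totient := by exact_mod_cast Nat.totient_pos.2 (Nat.pos_of_ne_zero hk)
  have : (0 : ℝ) < k := by exact_mod_cast Nat.pos_of_ne_zero hk
  have half_le : 1 / 2 ≤ k.totient / k * ∑ d ∈ k.divisors, (d : ℝ)⁻¹ :=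
    calc (1 / 2 : ℝ)
      _ ≤ ∏ p ∈ k.primeFactors, (1 - ((p : ℝ) ^ 2)⁻¹) :=
          half_le_prod_primeFactors_one_sub_inv_sq k
      _ = (∏ p ∈ k.primeFactors, (1 - (p : ℝ)⁻¹)) * ∏ p ∈ k.primeFactors, (1 + (p : ℝ)⁻¹) := by
          rw [← prod_mul_distrib]
          exact prod_congr rfl fun p _ => by ring
      _ ≤ k.totient / k * ∑ d ∈ k.divisors, (d : ℝ)⁻¹ := by
          rw [prod_primeFactors_one_sub_inv hk]
          gcongr
          exact prod_primeFactors_one_add_inv_le hk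
  rw [div_le_iff₀ hφ]
  calc (k : ℝ) = 2 * k * (1 / 2) := by ring
    _ ≤ 2 * k * (k.totient / k * ∑ d ∈ k.divisors, (d : ℝ)⁻¹) := by gcongr
    _ = 2 * (∑ d ∈ k.divisors, (d : ℝ)⁻¹) * k.totient := by field_simp

theorem sum_inv_sq_le_two (K : ℕ) : ∑ d ∈ Icc 1 K, ((d : ℝ) ^ 2)⁻¹ ≤ 2 := by
  have h := sum_Ioo_inv_sq_le (α := ℝ) 0 (K + 1)
  have Ioo_eq : Ioo 0 (K + 1) = Icc 1 K := by ext; simp; omega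
  simpa [Ioo_eq] using h

theorem sum_filter_dvd_inv_le {d : ℕ} (hd : 0 < d) (K : ℕ) :
    ∑ k ∈ Icc 1 K with d ∣ k, (k : ℝ)⁻¹ ≤ (d : ℝ)⁻¹ * ∑ k ∈ Icc 1 K, (k : ℝ)⁻¹ := by
  have multiples_subset : {k ∈ Icc 1 K | d ∣ k} ⊆ (Icc 1 K).image (d * ·) := by
    intro k hk
    obtain ⟨hk, c, rfl⟩ := mem_filter.1 hk
    obtain ⟨hk1, hkK⟩ := mem_Icc.1 hk
    exact mem_image.2 ⟨c, mem_Icc.2 ⟨Nat.pos_of_mul_pos_left hk1,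
      (Nat.le_mul_of_pos_left c hd).trans hkK⟩, rfl⟩
  calc ∑ k ∈ Icc 1 K with d ∣ k, (k : ℝ)⁻¹
    _ ≤ ∑ k ∈ (Icc 1 K).image (d * ·), (k : ℝ)⁻¹ :=
        sum_le_sum_of_subset_of_nonneg multiples_subset fun _ _ _ => by positivity
    _ = (d : ℝ)⁻¹ * ∑ k ∈ Icc 1 K, (k : ℝ)⁻¹ := by
        rw [sum_image fun a _ b _ => Nat.eq_of_mul_eq_mul_left hd, mul_sum]
        simp only [Nat.cast_mul, mul_inv]

theorem sum_inv_totient_le (K : ℕ) :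
    ∑ k ∈ Icc 1 K, (k.totient : ℝ)⁻¹ ≤ 4 * (1 + Real.log K) := by
  have inv_totient_le : ∀ k ∈ Icc 1 K,
      (k.totient : ℝ)⁻¹ ≤ 2 * ∑ d ∈ k.divisors, (d : ℝ)⁻¹ * (k : ℝ)⁻¹ := by
    intro k hk
    have hk1 : 0 < k := (mem_Icc.1 hk).1
    rw [← sum_mul, ← mul_assoc, ← div_eq_mul_inv, le_div_iff₀ (by exact_mod_cast hk1),
      inv_mul_eq_div]
    exact div_totient_le_two_mul_sum_divisors_inv hk1.ne'
  have swap : ∑ k ∈ Icc 1 K, ∑ d ∈ k.divisors, (d : ℝ)⁻¹ * (k : ℝ)⁻¹ =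
      ∑ d ∈ Icc 1 K, ∑ k ∈ Icc 1 K with d ∣ k, (d : ℝ)⁻¹ * (k : ℝ)⁻¹ := by
    refine sum_comm' fun k d => ?_
    simp only [mem_filter, mem_Icc, Nat.mem_divisors]
    constructor
    · rintro ⟨⟨hk1, hkK⟩, hdk, -⟩
      exact ⟨⟨⟨hk1, hkK⟩, hdk⟩, Nat.pos_of_dvd_of_pos hdk hk1, (Nat.le_of_dvd hk1 hdk).trans hkK⟩
    · rintro ⟨⟨⟨hk1, hkK⟩, hdk⟩, -⟩
      exact ⟨⟨hk1, hkK⟩, hdk, Nat.one_le_iff_ne_zero.1 hk1⟩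
  have inner_le : ∀ d ∈ Icc 1 K, ∑ k ∈ Icc 1 K with d ∣ k, (d : ℝ)⁻¹ * (k : ℝ)⁻¹ ≤
      ((d : ℝ) ^ 2)⁻¹ * ∑ k ∈ Icc 1 K, (k : ℝ)⁻¹ := by
    intro d hd
    rw [← mul_sum, sq, mul_inv, mul_assoc]
    gcongr
    exact sum_filter_dvd_inv_le (mem_Icc.1 hd).1 K
  calc ∑ k ∈ Icc 1 K, (k.totient : ℝ)⁻¹
    _ ≤ 2 * ∑ k ∈ Icc 1 K, ∑ d ∈ k.divisors, (d : ℝ)⁻¹ * (k : ℝ)⁻¹ := by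
        rw [mul_sum]
        exact sum_le_sum inv_totient_le
    _ ≤ 2 * ((∑ d ∈ Icc 1 K, ((d : ℝ) ^ 2)⁻¹) * ∑ k ∈ Icc 1 K, (k : ℝ)⁻¹) := by
        rw [swap, sum_mul]
        gcongr with d hd
        exact inner_le d hd
    _ ≤ 2 * (2 * (1 + Real.log K)) := by
        gcongr
        · exact sum_inv_sq_le_two K
        · exact sum_inv_le_one_add_log K
    _ = 4 * (1 + Real.log K) := by ring

end Totient

/-! ### The Brun–Titchmarsh inequality -/

section BrunTitchmarsh

theorem abs_card_filter_modEq_sub_div_le {r : ℕ} (hr : 0 < r) {a b : ℕ} (hab : a ≤ b) (v : ℕ) :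
    |(#{x ∈ Ioc a b | x ≡ v [MOD r]} : ℝ) - (b - a) / r| ≤ 1 := by
  suffices h : |(#{x ∈ Ioc a b | x ≡ v [MOD r]} : ℚ) - (b - a) / r| ≤ 1 by
    have hcast := (Rat.cast_le (K := ℝ)).2 h
    push_cast at hcast
    exact hcast
  have hfloor : ⌊((a : ℚ) - v) / r⌋ ≤ ⌊((b : ℚ) - v) / r⌋ := by gcongr
  have hcard : (#{x ∈ Ioc a b | x ≡ v [MOD r]} : ℚ) =
      ⌊((b : ℚ) - v) / r⌋ - ⌊((a : ℚ) - v) / r⌋ := by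
    have h := Nat.Ioc_filter_modEq_card a b hr v
    rw [max_eq_left (sub_nonneg.2 hfloor)] at h
    exact_mod_cast h
  have hsplit : ((b : ℚ) - a) / r = (b - v) / r - (a - v) / r := by ring
  rw [hcard, hsplit, abs_le]
  constructor <;>
    linarith [Int.floor_le (((a : ℚ) - v) / r), Int.lt_floor_add_one (((a : ℚ) - v) / r),
      Int.floor_le (((b : ℚ) - v) / r), Int.lt_floor_add_one (((b : ℚ) - v) / r)]

theorem exists_dvd_mul_add_iff_modEq {m d : ℕ} (hd : d ≠ 0) (hmd : m.Coprime d) (a : ℕ) :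
    ∃ r : ℕ, ∀ k, d ∣ m * k + a ↔ k ≡ r [MOD d] := by
  have : NeZero d := ⟨hd⟩
  have mul_inv : (m : ZMod d) * (m : ZMod d)⁻¹ = 1 := ZMod.coe_mul_inv_eq_one m hmd
  refine ⟨(-(a * (m : ZMod d)⁻¹)).val, fun k => ?_⟩
  rw [← ZMod.natCast_eq_natCast_iff, ← ZMod.natCast_eq_zero_iff, ZMod.natCast_zmod_val]
  push_cast
  constructor <;> intro h
  · linear_combination (m : ZMod d)⁻¹ * h - (k : ZMod d) * mul_inv
  · linear_combination (m : ZMod d) * h - (a : ZMod d) * mul_inv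

theorem abs_card_filter_dvd_mul_add_sub_le {m d : ℕ} (hd : d ≠ 0) (hmd : m.Coprime d)
    (a N : ℕ) : |(#{k ∈ Icc 1 N | d ∣ m * k + a} : ℝ) - (d : ℝ)⁻¹ * N| ≤ 1 := by
  obtain ⟨r, hr⟩ := exists_dvd_mul_add_iff_modEq hd hmd a
  have Icc_eq : Icc 1 N = Ioc 0 N := rfl
  have h := abs_card_filter_modEq_sub_div_le (Nat.pos_of_ne_zero hd) N.zero_le r
  simpa only [hr, Icc_eq, Nat.cast_zero, sub_zero, inv_mul_eq_div] using h

theorem primeFactors_coprimeRadical_primorial (m Z : ℕ) :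
    (coprimeRadical m (primorial Z)).primeFactors = Z.primesLE \ m.primeFactors := by
  rw [primeFactors_coprimeRadical, primeFactors_primorial]

theorem dvd_coprimeRadical_primorial {m Z l : ℕ} (hm : m ≠ 0) (hlZ : l ≤ Z) :
    l ∣ coprimeRadical m (primorial Z) ↔ Squarefree l ∧ l.Coprime m := by
  constructor
  · intro hl
    exact ⟨(squarefree_coprimeRadical m _).squarefree_of_dvd hl,
      (coprimeRadical_coprime hm _).coprime_dvd_left hl⟩
  · rintro ⟨hsq, hlm⟩
    rw [← Nat.prod_primeFactors_of_squarefree hsq, coprimeRadical, primeFactors_primorial]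
    refine prod_dvd_prod_of_subset _ _ _ fun p hp => mem_sdiff.2 ⟨?_, ?_⟩
    · exact Nat.mem_primesLE.2
        ⟨(Nat.le_of_mem_primeFactors hp).trans hlZ, Nat.prime_of_mem_primeFactors hp⟩
    · exact disjoint_left.1 hlm.disjoint_primeFactors hp

/-- The sieve of the numbers `m * k + a` with `1 ≤ k ≤ N` by the primes up to `Z` not dividing
`m`. The density `1 / d` is taken for all `d`, being relevant only for `d` coprime to `m`. -/
noncomputable def progressionSieve (m a N Z : ℕ) : BoundingSieve where
  support := (Icc 1 N).image fun k => m * k + a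
  prodPrimes := coprimeRadical m (primorial Z)
  prodPrimes_squarefree := squarefree_coprimeRadical m _
  weights := fun _ => 1
  weights_nonneg := fun _ => zero_le_one
  totalMass := N
  nu := ⟨fun n => (n : ℝ)⁻¹, by simp⟩
  nu_mult := ⟨by simp, fun _ => by simp [mul_comm]⟩
  nu_pos_of_prime := fun p hp _ => by simpa using hp.pos
  nu_lt_one_of_prime := fun p hp _ => by
    simpa using inv_lt_one_of_one_lt₀ (by exact_mod_cast hp.one_lt : (1 : ℝ) < p)

variable {m Z : ℕ}

theorem progressionSieve_nu (m a N Z n : ℕ) : (progressionSieve m a N Z).nu n = (n : ℝ)⁻¹ := rfl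

theorem sum_progressionSieve_support (hm : m ≠ 0) (a N Z : ℕ) (f : ℕ → ℝ) :
    ∑ n ∈ (progressionSieve m a N Z).support, f n = ∑ k ∈ Icc 1 N, f (m * k + a) :=
  sum_image fun _ _ _ _ h => Nat.eq_of_mul_eq_mul_left (Nat.pos_of_ne_zero hm)
    (Nat.add_right_cancel h)

theorem selbergSupport_progressionSieve (hm : m ≠ 0) (a N Z : ℕ) :
    selbergSupport (progressionSieve m a N Z) Z =
      {l ∈ Icc 1 Z | Squarefree l ∧ l.Coprime m} := by
  ext l
  rw [mem_selbergSupport, mem_filter, mem_Icc]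
  constructor
  · rintro ⟨hl, hlZ⟩
    have h := (dvd_coprimeRadical_primorial hm hlZ).1 hl
    exact ⟨⟨Nat.pos_of_ne_zero h.1.ne_zero, hlZ⟩, h⟩
  · rintro ⟨⟨-, hlZ⟩, h⟩
    exact ⟨(dvd_coprimeRadical_primorial hm hlZ).2 h, hlZ⟩

theorem selbergTerms_progressionSieve (m a N Z : ℕ) {l : ℕ} (hl : l ≠ 0) :
    (progressionSieve m a N Z).selbergTerms l = (l.totient : ℝ)⁻¹ := by
  simp only [BoundingSieve.selbergTerms_apply, progressionSieve_nu]
  rw [prod_inv_distrib, prod_primeFactors_one_sub_inv hl]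
  field_simp

theorem selbergSum_progressionSieve (hm : m ≠ 0) (a N Z : ℕ) :
    selbergSum (progressionSieve m a N Z) Z =
      ∑ l ∈ Icc 1 Z with Squarefree l ∧ l.Coprime m, (l.totient : ℝ)⁻¹ := by
  rw [selbergSum, selbergSupport_progressionSieve hm]
  exact sum_congr rfl fun l hl =>
    selbergTerms_progressionSieve m a N Z (mem_filter.1 hl).2.1.ne_zero

theorem abs_rem_progressionSieve_le (hm : m ≠ 0) (a N : ℕ) {d : ℕ}
    (hd : d ∣ (progressionSieve m a N Z).prodPrimes) :
    |(progressionSieve m a N Z).rem d| ≤ 1 := by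
  have hmd : m.Coprime d := ((coprimeRadical_coprime hm _).coprime_dvd_left hd).symm
  have hd0 : d ≠ 0 := ne_zero_of_dvd_ne_zero (squarefree_coprimeRadical m _).ne_zero hd
  have multSum_eq : (progressionSieve m a N Z).multSum d = #{k ∈ Icc 1 N | d ∣ m * k + a} := by
    rw [BoundingSieve.multSum, sum_progressionSieve_support hm]
    exact sum_boole _ _
  rw [BoundingSieve.rem, multSum_eq]
  exact abs_card_filter_dvd_mul_add_sub_le hd0 hmd a N

theorem card_prime_mul_add_le_add_siftedSum (hm : m ≠ 0) (a N Z : ℕ) :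
    (#{k ∈ Icc 1 N | (m * k + a).Prime} : ℝ) ≤ Z + (progressionSieve m a N Z).siftedSum := by
  set P := coprimeRadical m (primorial Z)
  have siftedSum_eq : (progressionSieve m a N Z).siftedSum =
      #{k ∈ Icc 1 N | P.Coprime (m * k + a)} := by
    rw [BoundingSieve.siftedSum, sum_progressionSieve_support hm]
    exact sum_boole _ _
  have prime_subset : {k ∈ Icc 1 N | (m * k + a).Prime} ⊆
      Icc 1 Z ∪ {k ∈ Icc 1 N | P.Coprime (m * k + a)} := by
    intro k hk
    obtain ⟨hkN, hprime⟩ := mem_filter.1 hk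
    rw [mem_union, mem_filter, mem_Icc]
    by_cases hkZ : k ≤ Z
    · exact Or.inl ⟨(mem_Icc.1 hkN).1, hkZ⟩
    · refine Or.inr ⟨hkN, Nat.Coprime.symm ((hprime.coprime_iff_not_dvd).2 fun hdvd => ?_)⟩
      have hmem := hprime.mem_primeFactors hdvd (squarefree_coprimeRadical m _).ne_zero
      rw [primeFactors_coprimeRadical_primorial, mem_sdiff, Nat.mem_primesLE] at hmem
      have := Nat.le_mul_of_pos_left k (Nat.pos_of_ne_zero hm)
      omega
  have h := (card_le_card prime_subset).trans (card_union_le _ _)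
  rw [Nat.card_Icc, Nat.add_sub_cancel] at h
  rw [siftedSum_eq]
  exact_mod_cast h

theorem card_prime_mul_add_le (hm : m ≠ 0) (hZ : 1 ≤ Z) (a N : ℕ) :
    (#{k ∈ Icc 1 N | (m * k + a).Prime} : ℝ) ≤
      m / m.totient * (N / Real.log (Z + 1)) + Z + (Z : ℝ) ^ 4 := by
  set s := progressionSieve m a N Z
  have hlog : 0 < Real.log (Z + 1) := Real.log_pos (by exact_mod_cast Nat.lt_add_one_of_le hZ)
  have hS : 0 < selbergSum s Z := selbergSum_pos hZ
  have log_le : Real.log (Z + 1) ≤ m / m.totient * selbergSum s Z := by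
    rw [selbergSum_progressionSieve hm]
    exact (log_add_one_le_sum_inv Z).trans (sum_inv_le_div_totient_mul_sum_inv_totient hm Z)
  have main_le : s.totalMass / selbergSum s Z ≤ m / m.totient * (N / Real.log (Z + 1)) := by
    rw [div_le_iff₀ hS]
    calc (N : ℝ) = N / Real.log (Z + 1) * Real.log (Z + 1) := by field_simp
      _ ≤ N / Real.log (Z + 1) * (m / m.totient * selbergSum s Z) := by gcongr
      _ = _ := by ring
  have error_le : ∑ d ∈ selbergSupport s Z, (s.nu d)⁻¹ ≤ (Z : ℝ) ^ 2 := by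
    rw [selbergSupport_progressionSieve hm]
    calc ∑ d ∈ Icc 1 Z with Squarefree d ∧ d.Coprime m, (s.nu d)⁻¹
      _ ≤ ∑ d ∈ Icc 1 Z, (d : ℝ) := by
          simp only [s, progressionSieve_nu, inv_inv]
          exact sum_le_sum_of_subset_of_nonneg (filter_subset _ _) fun _ _ _ => by positivity
      _ ≤ ∑ _d ∈ Icc 1 Z, (Z : ℝ) :=
          sum_le_sum fun _ hd => by exact_mod_cast (mem_Icc.1 hd).2
      _ = (Z : ℝ) ^ 2 := by simp [sq]
  have error_nonneg : 0 ≤ ∑ d ∈ selbergSupport s Z, (s.nu d)⁻¹ :=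
    sum_nonneg fun d _ => by simp [s, progressionSieve_nu]
  calc (#{k ∈ Icc 1 N | (m * k + a).Prime} : ℝ)
    _ ≤ Z + s.siftedSum := card_prime_mul_add_le_add_siftedSum hm a N Z
    _ ≤ Z + (s.totalMass / selbergSum s Z + 1 * (∑ d ∈ selbergSupport s Z, (s.nu d)⁻¹) ^ 2) := by
        gcongr
        exact siftedSum_le_selberg hZ fun d => abs_rem_progressionSieve_le hm a N
    _ ≤ Z + (m / m.totient * (N / Real.log (Z + 1)) + 1 * ((Z : ℝ) ^ 2) ^ 2) := by gcongr
    _ = _ := by ring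

theorem brun_titchmarsh (hm : m ≠ 0) (a : ℕ) {y : ℝ} (hy : 1 < y) :
    (#{k ∈ Icc 1 ⌊y⌋₊ | (m * k + a).Prime} : ℝ) ≤
      12 * (m / m.totient) * (y / Real.log y) := by
  have hy0 : 0 < y := zero_lt_one.trans hy
  have hlog : 0 < Real.log y := Real.log_pos hy
  have one_le_ratio : (1 : ℝ) ≤ m / m.totient := by
    rw [one_le_div (by exact_mod_cast Nat.totient_pos.2 (Nat.pos_of_ne_zero hm))]
    exact_mod_cast Nat.totient_le m
  set Z : ℕ := ⌊y ^ (1 / 8 : ℝ)⌋₊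
  have hZ : 1 ≤ Z := Nat.le_floor (by simpa using Real.one_le_rpow hy.le (by norm_num))
  have log_le : Real.log y / 8 ≤ Real.log (Z + 1) := by
    have h := Real.log_le_log (by positivity) (Nat.lt_floor_add_one (y ^ (1 / 8 : ℝ))).le
    rw [Real.log_rpow hy0] at h
    linarith
  have pow_le : (Z : ℝ) ^ 4 ≤ 2 * (y / Real.log y) := by
    have log_le_sqrt : Real.log y ≤ y ^ (1 / 2 : ℝ) / (1 / 2) :=
      Real.log_le_rpow_div hy0.le (by norm_num)
    calc (Z : ℝ) ^ 4 ≤ (y ^ (1 / 8 : ℝ)) ^ 4 := by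
          gcongr
          exact Nat.floor_le (by positivity)
      _ = y ^ (1 / 2 : ℝ) := by rw [← Real.rpow_mul_natCast hy0.le]; norm_num
      _ ≤ 2 * (y / Real.log y) := by
          have sqrt_sq : y ^ (1 / 2 : ℝ) * y ^ (1 / 2 : ℝ) = y := by
            rw [← Real.rpow_add hy0]; norm_num
          rw [← mul_div_assoc, le_div_iff₀ hlog]
          nlinarith [Real.rpow_pos_of_pos hy0 (1 / 2)]
  have le_pow : (Z : ℝ) ≤ (Z : ℝ) ^ 4 := le_self_pow₀ (by exact_mod_cast hZ) (by norm_num)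
  calc (#{k ∈ Icc 1 ⌊y⌋₊ | (m * k + a).Prime} : ℝ)
    _ ≤ m / m.totient * (⌊y⌋₊ / Real.log (Z + 1)) + Z + (Z : ℝ) ^ 4 :=
        card_prime_mul_add_le hm hZ a _
    _ ≤ m / m.totient * (y / (Real.log y / 8)) + 2 * (y / Real.log y) + 2 * (y / Real.log y) := by
        gcongr
        · exact Nat.floor_le hy0.le
        · exact le_pow.trans pow_le
    _ = 8 * (m / m.totient) * (y / Real.log y) + 4 * 1 * (y / Real.log y) := by ring
    _ ≤ 8 * (m / m.totient) * (y / Real.log y) + 4 * (m / m.totient) * (y / Real.log y) := by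
        gcongr
    _ = _ := by ring

end BrunTitchmarsh

/-! ### The two integrals -/

section Integrals

/-- The integral `∫_a^b π(t;m,1)/(t-1)² dt`. -/
noncomputable def primesIntegral (m : ℕ) (a b : ℝ) : ℝ :=
  ∫ t in a..b, (primesMod t m 1 : ℝ) / (t - 1) ^ 2

/-- The sum of `1 / (p - 1)` over the primes `p = m * k + 1` with `k ≤ K`. -/
noncomputable def sumInvPrimes (m K : ℕ) : ℝ :=
  ∑ k ∈ Icc 1 K with (m * k + 1).Prime, ((m : ℝ) * k)⁻¹

theorem sumInvPrimes_nonneg (m K : ℕ) : 0 ≤ sumInvPrimes m K :=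
  sum_nonneg fun _ _ => by positivity

theorem sumInvPrimes_mono (m : ℕ) : Monotone (sumInvPrimes m) := fun _ _ h =>
  sum_le_sum_of_subset_of_nonneg (filter_subset_filter _ (Icc_subset_Icc_right h))
    fun _ _ _ => by positivity

theorem primesMod_mono (m a : ℕ) : Monotone fun t : ℝ => primesMod t m a := fun _ _ hst =>
  card_le_card (filter_subset_filter _ (Icc_subset_Icc_right (Nat.floor_le_floor hst)))

theorem primesMod_eq_zero_of_lt_two {t : ℝ} (ht : t < 2) (m a : ℕ) : primesMod t m a = 0 := by
  refine card_eq_zero.2 (filter_eq_empty_iff.2 fun p hp h => ?_)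
  have h_floor : ⌊t⌋₊ < 2 := (Nat.floor_lt' two_ne_zero).2 (by exact_mod_cast ht)
  exact (h.1.two_le.trans (mem_Icc.1 hp).2).not_gt h_floor

theorem filter_prime_modEq_one_subset_image (m n : ℕ) :
    {p ∈ Icc 1 n | p.Prime ∧ p ≡ 1 [MOD m]} ⊆
      {k ∈ Icc 1 (n / m) | (m * k + 1).Prime}.image (m * · + 1) := by
  intro p hp
  simp only [mem_filter, mem_Icc] at hp
  obtain ⟨⟨hp1, hpn⟩, hp_prime, hp_mod⟩ := hp
  obtain ⟨k, hk⟩ := (Nat.modEq_iff_dvd' hp1).1 hp_mod.symm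
  obtain rfl : p = m * k + 1 := by omega
  have hmk : m * k ≠ 0 := fun h => Nat.not_prime_one (by simpa [h] using hp_prime)
  have hm : 0 < m := Nat.pos_of_ne_zero (left_ne_zero_of_mul hmk)
  refine mem_image_of_mem _ (mem_filter.2 ⟨mem_Icc.2 ⟨?_, ?_⟩, hp_prime⟩)
  · exact Nat.one_le_iff_ne_zero.2 (right_ne_zero_of_mul hmk)
  · exact (Nat.le_div_iff_mul_le hm).2 (by rw [mul_comm]; omega)

theorem primesMod_one_le (m : ℕ) (t : ℝ) :
    primesMod t m 1 ≤ #{k ∈ Icc 1 ⌊t / m⌋₊ | (m * k + 1).Prime} := by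
  rw [Nat.floor_div_natCast]
  exact (card_le_card (filter_prime_modEq_one_subset_image m ⌊t⌋₊)).trans card_image_le

theorem sum_inv_sub_one_le_sumInvPrimes {m : ℕ} (hm : m ≠ 0) (n : ℕ) :
    ∑ p ∈ Icc 1 n with p.Prime ∧ p ≡ 1 [MOD m], ((p : ℝ) - 1)⁻¹ ≤ sumInvPrimes m (n / m) := by
  calc _ ≤ ∑ p ∈ {k ∈ Icc 1 (n / m) | (m * k + 1).Prime}.image (m * · + 1),
        ((p : ℝ) - 1)⁻¹ := by
        refine sum_le_sum_of_subset_of_nonneg (filter_prime_modEq_one_subset_image m n)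
          fun p hp _ => ?_
        obtain ⟨k, -, rfl⟩ := mem_image.1 hp
        push_cast
        rw [add_sub_cancel_right]
        positivity
    _ = sumInvPrimes m (n / m) := by
        rw [sum_image fun _ _ _ _ h => Nat.eq_of_mul_eq_mul_left (Nat.pos_of_ne_zero hm)
          (Nat.succ.inj h)]
        refine sum_congr rfl fun k _ => ?_
        push_cast
        rw [add_sub_cancel_right]

theorem intervalIntegrable_primesMod_div (m : ℕ) {a b : ℝ} (ha : 1 < a) (hb : 1 < b) :
    IntervalIntegrable (fun t => (primesMod t m 1 : ℝ) / (t - 1) ^ 2) volume a b := by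
  have h_mono : Monotone fun t : ℝ => (primesMod t m 1 : ℝ) :=
    fun _ _ h => Nat.cast_le.2 (primesMod_mono m 1 h)
  simp_rw [div_eq_mul_inv]
  refine h_mono.intervalIntegrable.mul_continuousOn ?_
  refine ContinuousOn.inv₀ (by fun_prop) fun t ht => pow_ne_zero 2 ?_
  have : 1 < t := (lt_inf_iff.2 ⟨ha, hb⟩).trans_le ht.1
  linarith

theorem primesIntegral_nonneg (m : ℕ) {a b : ℝ} (hab : a ≤ b) : 0 ≤ primesIntegral m a b :=
  intervalIntegral.integral_nonneg hab fun _ _ => by positivity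

theorem primesIntegral_two_eq_zero (m : ℕ) {T : ℝ} (hT : T ≤ 2) : primesIntegral m 2 T = 0 := by
  refine intervalIntegral.integral_zero_ae ?_
  filter_upwards [compl_mem_ae_iff.2 (measure_singleton (2 : ℝ))] with t ht_ne ht
  rw [Set.uIoc_of_ge hT] at ht
  simp [primesMod_eq_zero_of_lt_two (ht.2.lt_of_ne ht_ne)]

theorem primesIntegral_two_nonneg (m : ℕ) (T : ℝ) : 0 ≤ primesIntegral m 2 T := by
  rcases le_total T 2 with hT | hT
  · exact (primesIntegral_two_eq_zero m hT).ge
  · exact primesIntegral_nonneg m hT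

theorem hasDerivAt_inv_sub_one {t : ℝ} (ht : 2 ≤ t) :
    HasDerivAt (fun t : ℝ => (t - 1)⁻¹) (-((t - 1) ^ 2)⁻¹) t := by
  simpa [neg_div] using ((hasDerivAt_id' t).sub_const 1).fun_inv (by linarith)

theorem primesIntegral_two_le_sum (m : ℕ) {T : ℝ} (hT : 2 ≤ T) :
    primesIntegral m 2 T ≤
      ∑ p ∈ Icc 1 ⌊T⌋₊ with p.Prime ∧ p ≡ 1 [MOD m], ((p : ℝ) - 1)⁻¹ := by
  let c : ℕ → ℝ := fun p => if p.Prime ∧ p ≡ 1 [MOD m] then 1 else 0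
  have hc0 : c 0 = 0 := by simp [c, Nat.not_prime_zero]
  have hc1 : c 1 = 0 := by simp [c, Nat.not_prime_one]
  have h_Icc (f : ℕ → ℝ) (n : ℕ) : ∑ p ∈ Icc 0 n, f p * c p =
      ∑ p ∈ Icc 1 n with p.Prime ∧ p ≡ 1 [MOD m], f p := by
    rw [← sum_Ioc_add_eq_sum_Icc n.zero_le, hc0, mul_zero, add_zero, sum_filter]
    simp only [c, mul_ite, mul_one, mul_zero]
    rfl
  have h_count (t : ℝ) : ∑ p ∈ Icc 0 ⌊t⌋₊, c p = primesMod t m 1 := by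
    simpa [primesMod] using h_Icc 1 ⌊t⌋₊
  have h_deriv {t : ℝ} (ht : t ∈ Set.Icc 2 T) :
      deriv (fun t : ℝ => (t - 1)⁻¹) t = -((t - 1) ^ 2)⁻¹ := (hasDerivAt_inv_sub_one ht.1).deriv
  have h_int : IntegrableOn (deriv fun t : ℝ => (t - 1)⁻¹) (Set.Icc 2 T) := by
    refine (integrableOn_congr_fun (fun t ht => h_deriv ht) measurableSet_Icc).2 ?_
    refine ContinuousOn.integrableOn_Icc ((ContinuousOn.inv₀ (by fun_prop) fun t ht => ?_).neg)
    have : 2 ≤ t := ht.1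
    exact pow_ne_zero 2 (by linarith)
  have h_abel := sum_mul_eq_sub_integral_mul₁ c hc0 hc1 T
    (fun t ht => (hasDerivAt_inv_sub_one ht.1).differentiableAt) h_int
  have h_integral : ∫ t in Set.Ioc 2 T, deriv (fun t : ℝ => (t - 1)⁻¹) t * ∑ p ∈ Icc 0 ⌊t⌋₊, c p =
      -primesIntegral m 2 T := by
    rw [primesIntegral, intervalIntegral.integral_of_le hT, ← integral_neg]
    refine setIntegral_congr_fun measurableSet_Ioc fun t ht => ?_
    simp only [h_deriv ⟨ht.1.le, ht.2⟩, h_count]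
    ring
  rw [h_integral, h_Icc, h_count] at h_abel
  have h_boundary : 0 ≤ (T - 1)⁻¹ * (primesMod T m 1 : ℝ) :=
    mul_nonneg (inv_nonneg.2 (by linarith)) (Nat.cast_nonneg _)
  linarith

theorem primesIntegral_two_le_sumInvPrimes {m : ℕ} (hm : m ≠ 0) {T : ℝ} (hT : 2 ≤ T) :
    primesIntegral m 2 T ≤ sumInvPrimes m ⌊T / m⌋₊ := by
  rw [Nat.floor_div_natCast]
  exact (primesIntegral_two_le_sum m hT).trans (sum_inv_sub_one_le_sumInvPrimes hm _)

theorem primesMod_div_le {m : ℕ} (hm : m ≠ 0) {t : ℝ} (ht2 : 2 ≤ t) (hmt : (m : ℝ) < t) :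
    (primesMod t m 1 : ℝ) / (t - 1) ^ 2 ≤ 48 / m.totient * (t⁻¹ * (Real.log (t / m))⁻¹) := by
  have hm0 : (0 : ℝ) < m := Nat.cast_pos.2 (Nat.pos_of_ne_zero hm)
  have hy : 1 < t / m := (one_lt_div hm0).2 hmt
  have h_log : 0 < Real.log (t / m) := Real.log_pos hy
  have : (0 : ℝ) < m.totient := Nat.cast_pos.2 (Nat.totient_pos.2 (Nat.pos_of_ne_zero hm))
  have h_count : (primesMod t m 1 : ℝ) ≤ 12 * (m / m.totient) * (t / m / Real.log (t / m)) :=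
    (Nat.cast_le.2 (primesMod_one_le m t)).trans (brun_titchmarsh hm 1 hy)
  have h_sq : t ^ 2 / 4 ≤ (t - 1) ^ 2 := by nlinarith
  calc (primesMod t m 1 : ℝ) / (t - 1) ^ 2
      ≤ (12 * (m / m.totient) * (t / m / Real.log (t / m))) / (t ^ 2 / 4) := by gcongr
    _ = _ := by field_simp; norm_num

theorem hasDerivAt_log_log_div {c t : ℝ} (hc : 0 < c) (hct : c < t) :
    HasDerivAt (fun t : ℝ => Real.log (Real.log (t / c))) (t⁻¹ * (Real.log (t / c))⁻¹) t := by
  have ht : 0 < t := hc.trans hct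
  have h_log : 0 < Real.log (t / c) := Real.log_pos ((one_lt_div hc).2 hct)
  convert (((hasDerivAt_id' t).div_const c).log (by positivity)).log h_log.ne' using 1
  field_simp

theorem totient_mul_primesIntegral_le {m : ℕ} (hm : m ≠ 0) {T x : ℝ} (hT : 2 ≤ T)
    (hmT : (m : ℝ) < T) (hTx : T ≤ x) :
    m.totient * primesIntegral m T x ≤
      48 * (Real.log (Real.log (x / m)) - Real.log (Real.log (T / m))) := by
  have hm0 : (0 : ℝ) < m := Nat.cast_pos.2 (Nat.pos_of_ne_zero hm)
  have : (0 : ℝ) < m.totient := Nat.cast_pos.2 (Nat.totient_pos.2 (Nat.pos_of_ne_zero hm))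
  have h_lt {t : ℝ} (ht : t ∈ Set.uIcc T x) : (m : ℝ) < t := by
    rw [Set.uIcc_of_le hTx] at ht
    exact hmT.trans_le ht.1
  have h_cont : ContinuousOn (fun t : ℝ => t⁻¹ * (Real.log (t / m))⁻¹) (Set.uIcc T x) := by
    refine continuousOn_of_forall_continuousAt fun t ht => ?_
    have ht0 : 0 < t := hm0.trans (h_lt ht)
    have h_log : Real.log (t / m) ≠ 0 := (Real.log_pos ((one_lt_div hm0).2 (h_lt ht))).ne'
    fun_prop (disch := first | assumption | positivity)
  have h_ftc := intervalIntegral.integral_eq_sub_of_hasDerivAt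
    (fun t ht => hasDerivAt_log_log_div hm0 (h_lt ht)) h_cont.intervalIntegrable
  have h_le : primesIntegral m T x ≤
      ∫ t in T..x, 48 / m.totient * (t⁻¹ * (Real.log (t / m))⁻¹) :=
    intervalIntegral.integral_mono_on hTx
      (intervalIntegrable_primesMod_div m (by linarith) (by linarith))
      (h_cont.intervalIntegrable.const_mul _)
      fun t ht => primesMod_div_le hm (hT.trans ht.1) (hmT.trans_le ht.1)
  rw [intervalIntegral.integral_const_mul, h_ftc] at h_le
  calc _ ≤ (m.totient : ℝ) * (48 / m.totient *
        (Real.log (Real.log (x / m)) - Real.log (Real.log (T / m)))) := by gcongr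
    _ = _ := by field_simp

end Integrals

/-! ### Dyadic averages over the modulus -/

section DyadicBlocks

theorem half_lt_log_two : 1 / 2 < Real.log 2 := by linarith [Real.log_two_gt_d9]

theorem sumInvPrimes_le_of_le {m N : ℕ} (hN : 0 < N) (hNm : N ≤ m) (K : ℕ) :
    sumInvPrimes m K ≤ ∑ k ∈ Icc 1 K with (m * k + 1).Prime, ((N : ℝ) * k)⁻¹ := by
  refine sum_le_sum fun k hk => ?_
  have hk0 : 0 < k := (mem_Icc.1 (mem_filter.1 hk).1).1
  gcongr

theorem card_Ico_prime_mul_add_one_le {k N : ℕ} (hk : k ≠ 0) (hN : 0 < N) :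
    (#{m ∈ Ico N (2 * N) | (m * k + 1).Prime} : ℝ) ≤
      24 / Real.log (2 * N) * (k * N / k.totient) := by
  have h_one_lt : (1 : ℝ) < 2 * N := by exact_mod_cast (by omega : 1 < 2 * N)
  have h_floor : ⌊(2 * N : ℝ)⌋₊ = 2 * N := by exact_mod_cast Nat.floor_natCast (R := ℝ) (2 * N)
  have h_subset : {m ∈ Ico N (2 * N) | (m * k + 1).Prime} ⊆
      {m ∈ Icc 1 (2 * N) | (k * m + 1).Prime} := fun m hm => by
    simp only [mem_filter, mem_Ico, mem_Icc, mul_comm k] at hm ⊢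
    exact ⟨by omega, hm.2⟩
  calc _ ≤ (#{m ∈ Icc 1 ⌊(2 * N : ℝ)⌋₊ | (k * m + 1).Prime} : ℝ) := by
        rw [h_floor]
        exact Nat.cast_le.2 (card_le_card h_subset)
    _ ≤ 12 * (k / k.totient) * (2 * N / Real.log (2 * N)) := brun_titchmarsh hk 1 h_one_lt
    _ = _ := by ring

theorem sum_sumInvPrimes_Ico_le {N : ℕ} (hN : 0 < N) (K : ℕ) :
    ∑ m ∈ Ico N (2 * N), sumInvPrimes m K ≤ 96 * (1 + Real.log K) / Real.log (2 * N) := by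
  have h_log : 0 ≤ Real.log (2 * N) := Real.log_nonneg (by exact_mod_cast (by omega : 1 ≤ 2 * N))
  have hN0 : (N : ℝ) ≠ 0 := by positivity
  calc ∑ m ∈ Ico N (2 * N), sumInvPrimes m K
    _ ≤ ∑ m ∈ Ico N (2 * N), ∑ k ∈ Icc 1 K with (m * k + 1).Prime, ((N : ℝ) * k)⁻¹ :=
        sum_le_sum fun m hm => sumInvPrimes_le_of_le hN (mem_Ico.1 hm).1 K
    -- From here on `k` is the modulus of the progression containing `p = m * k + 1`.
    _ = ∑ k ∈ Icc 1 K, #{m ∈ Ico N (2 * N) | (m * k + 1).Prime} * ((N : ℝ) * k)⁻¹ := by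
        simp_rw [sum_filter]
        rw [sum_comm]
        simp_rw [← sum_filter, sum_const, nsmul_eq_mul]
    _ ≤ ∑ k ∈ Icc 1 K, 24 / Real.log (2 * N) * (k.totient : ℝ)⁻¹ := by
        refine sum_le_sum fun k hk => ?_
        have hk0 : k ≠ 0 := Nat.one_le_iff_ne_zero.1 (mem_Icc.1 hk).1
        calc _ ≤ 24 / Real.log (2 * N) * (k * N / k.totient) * ((N : ℝ) * k)⁻¹ := by
              gcongr
              exact card_Ico_prime_mul_add_one_le hk0 hN
          _ = _ := by field_simp
    _ ≤ 24 / Real.log (2 * N) * (4 * (1 + Real.log K)) := by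
        rw [← mul_sum]
        gcongr
        exact sum_inv_totient_le K
    _ = _ := by ring

theorem sum_sumInvPrimes_floor_rpow_le {ε : ℝ} (hε : 0 ≤ ε) {N : ℕ} (hN : 0 < N) :
    ∑ m ∈ Ico N (2 * N), sumInvPrimes m ⌊(m : ℝ) ^ ε⌋₊ ≤ 96 * (ε + (Real.log (2 * N))⁻¹) := by
  have h_one_lt : (1 : ℝ) < 2 * N := by exact_mod_cast (by omega : 1 < 2 * N)
  have h_log : 0 < Real.log (2 * N) := Real.log_pos h_one_lt
  set K := ⌊(2 * N : ℝ) ^ ε⌋₊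
  have hK : 0 < K := Nat.floor_pos.2 (Real.one_le_rpow h_one_lt.le hε)
  have log_K_le : Real.log K ≤ ε * Real.log (2 * N) := by
    rw [← Real.log_rpow (by positivity)]
    exact Real.log_le_log (by positivity) (Nat.floor_le (by positivity))
  calc ∑ m ∈ Ico N (2 * N), sumInvPrimes m ⌊(m : ℝ) ^ ε⌋₊
    _ ≤ ∑ m ∈ Ico N (2 * N), sumInvPrimes m K := by
        refine sum_le_sum fun m hm => sumInvPrimes_mono m (Nat.floor_le_floor ?_)
        have hm_le : (m : ℝ) ≤ 2 * N := by exact_mod_cast (mem_Ico.1 hm).2.le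
        gcongr
    _ ≤ 96 * (1 + Real.log K) / Real.log (2 * N) := sum_sumInvPrimes_Ico_le hN K
    _ ≤ 96 * (1 + ε * Real.log (2 * N)) / Real.log (2 * N) := by gcongr
    _ = _ := by field_simp; ring

theorem half_mul_le_log {j m : ℕ} (hm : 2 ^ j ≤ m) : (j : ℝ) / 2 ≤ Real.log m := by
  calc (j : ℝ) / 2 = j * (1 / 2) := by ring
    _ ≤ j * Real.log 2 := by gcongr; exact half_lt_log_two.le
    _ = Real.log (2 ^ j) := (Real.log_pow _ _).symm
    _ ≤ Real.log m := Real.log_le_log (by positivity) (by exact_mod_cast hm)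

theorem sum_sumInvPrimes_dyadic_le {ε : ℝ} (hε : 0 ≤ ε) {j : ℕ} (hj : 0 < j) :
    ∑ m ∈ Ico (2 ^ j) (2 ^ (j + 1)), sumInvPrimes m ⌊(m : ℝ) ^ ε⌋₊ ≤ 192 * (ε + (j : ℝ)⁻¹) := by
  have h_log : (j : ℝ) / 2 ≤ Real.log (2 * (2 ^ j : ℕ)) := by
    exact_mod_cast half_mul_le_log (m := 2 * 2 ^ j) (by omega)
  calc _ ≤ 96 * (ε + (Real.log (2 * (2 ^ j : ℕ)))⁻¹) := by
        rw [pow_succ']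
        exact sum_sumInvPrimes_floor_rpow_le hε (by positivity)
    _ ≤ 96 * (ε + ((j : ℝ) / 2)⁻¹) := by gcongr
    _ ≤ 192 * (ε + (j : ℝ)⁻¹) := by rw [inv_div, div_eq_mul_inv]; linarith

theorem sqrt_div_log_le {X : ℝ} (hX : 0 ≤ X) {j m : ℕ} (hj : 0 < j) (hm : 2 ^ j ≤ m) :
    √(X / Real.log m) ≤ 2 * √X * (√j)⁻¹ := by
  rw [Real.sqrt_le_left (by positivity), mul_pow, mul_pow, inv_pow, Real.sq_sqrt hX,
    Real.sq_sqrt (Nat.cast_nonneg j)]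
  calc X / Real.log m ≤ X / (j / 2) := by
        gcongr
        exact half_mul_le_log hm
    _ = 2 * (X * (j : ℝ)⁻¹) := by field_simp
    _ ≤ 2 ^ 2 * X * (j : ℝ)⁻¹ := by
        have : 0 ≤ X * (j : ℝ)⁻¹ := by positivity
        linarith

theorem sum_Ico_two_two_pow_succ {M : Type*} [AddCommMonoid M] (f : ℕ → M) (J : ℕ) :
    ∑ m ∈ Ico 2 (2 ^ (J + 1)), f m = ∑ j ∈ Icc 1 J, ∑ m ∈ Ico (2 ^ j) (2 ^ (j + 1)), f m := by
  induction J with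
  | zero => simp
  | succ J ih =>
    rw [sum_Icc_succ_top (by omega), ← ih, sum_Ico_consecutive]
    · exact Nat.le_self_pow J.succ_ne_zero 2
    · exact Nat.pow_le_pow_right two_pos (J + 1).le_succ

theorem sum_Ico_two_mul_sqrt_le {ε L X : ℝ} (hε : 0 ≤ ε) (hL : 0 ≤ L) (hX : 0 ≤ X) (J : ℕ) :
    ∑ m ∈ Ico 2 (2 ^ (J + 1)),
        sumInvPrimes m ⌊(m : ℝ) ^ ε⌋₊ * (L + 2 * √(X / Real.log m)) ≤
      192 * ∑ j ∈ Icc 1 J, (ε + (j : ℝ)⁻¹) * (L + 4 * √X * (√j)⁻¹) := by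
  rw [sum_Ico_two_two_pow_succ, mul_sum]
  refine sum_le_sum fun j hj => ?_
  have hj0 : 0 < j := (mem_Icc.1 hj).1
  calc _ ≤ ∑ m ∈ Ico (2 ^ j) (2 ^ (j + 1)),
        sumInvPrimes m ⌊(m : ℝ) ^ ε⌋₊ * (L + 4 * √X * (√j)⁻¹) := by
        refine sum_le_sum fun m hm => mul_le_mul_of_nonneg_left ?_ (sumInvPrimes_nonneg _ _)
        linarith [sqrt_div_log_le hX hj0 (mem_Ico.1 hm).1]
    _ ≤ 192 * (ε + (j : ℝ)⁻¹) * (L + 4 * √X * (√j)⁻¹) := by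
        rw [← sum_mul]
        exact mul_le_mul_of_nonneg_right (sum_sumInvPrimes_dyadic_le hε hj0) (by positivity)
    _ = _ := mul_assoc _ _ _

end DyadicBlocks

/-! ### The cross sum -/

section CrossSum

variable {ε x : ℝ} {m : ℕ}

theorem rpow_one_add_le_of_le_rpow_one_sub (hε : -1 ≤ ε) (hx : 1 ≤ x)
    (hmx : (m : ℝ) ≤ x ^ (1 - ε)) : (m : ℝ) ^ (1 + ε) ≤ x := by
  calc (m : ℝ) ^ (1 + ε) ≤ (x ^ (1 - ε)) ^ (1 + ε) := by gcongr; linarith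
    _ = x ^ (1 - ε ^ 2) := by rw [← Real.rpow_mul (by linarith)]; ring_nf
    _ ≤ x ^ (1 : ℝ) := Real.rpow_le_rpow_of_exponent_le hx (by nlinarith)
    _ = x := Real.rpow_one x

theorem log_log_sub_log_log_rpow_le (hε : 0 < ε) {a : ℝ} (ha : 1 < a) (hax : a < x) :
    Real.log (Real.log (x / a)) - Real.log (Real.log (a ^ ε)) ≤
      Real.log ε⁻¹ + 2 * √(Real.log x / Real.log a) := by
  have ha0 : 0 < a := zero_lt_one.trans ha
  have hx0 : 0 < x := ha0.trans hax
  have log_a_pos : 0 < Real.log a := Real.log_pos ha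
  have log_x_pos : 0 < Real.log x := Real.log_pos (ha.trans hax)
  have h_num : Real.log (Real.log (x / a)) ≤ Real.log (Real.log x) :=
    Real.log_le_log (Real.log_pos ((one_lt_div ha0).2 hax))
      (Real.log_le_log (by positivity) (div_le_self hx0.le ha.le))
  have h_sqrt : Real.log (Real.log x / Real.log a) ≤ 2 * √(Real.log x / Real.log a) := by
    have h_ratio : 0 < Real.log x / Real.log a := div_pos log_x_pos log_a_pos
    have h := Real.log_le_self (Real.sqrt_nonneg (Real.log x / Real.log a))
    rw [Real.log_sqrt h_ratio.le] at h
    linarith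
  rw [Real.log_div log_x_pos.ne' log_a_pos.ne'] at h_sqrt
  rw [Real.log_rpow ha0, Real.log_mul hε.ne' log_a_pos.ne', Real.log_inv]
  linarith

theorem totient_mul_primesIntegral_mul_le (hε : 0 < ε) (hm : 2 ≤ m)
    (hmx : (m : ℝ) ^ (1 + ε) ≤ x) :
    m.totient * primesIntegral m 2 (m ^ (1 + ε)) * primesIntegral m (m ^ (1 + ε)) x ≤
      48 * (sumInvPrimes m ⌊(m : ℝ) ^ ε⌋₊ *
        (Real.log ε⁻¹ + 2 * √(Real.log x / Real.log m))) := by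
  have hm0 : m ≠ 0 := by omega
  have hm2 : (2 : ℝ) ≤ m := by exact_mod_cast hm
  set T : ℝ := (m : ℝ) ^ (1 + ε) with hT
  have hmT : (m : ℝ) < T := Real.self_lt_rpow_of_one_lt (by linarith) (by linarith)
  have hT_div : T / m = (m : ℝ) ^ ε := by
    rw [hT, Real.rpow_add (by linarith), Real.rpow_one, mul_div_cancel_left₀ _ (by linarith)]
  have h_low : primesIntegral m 2 T ≤ sumInvPrimes m ⌊(m : ℝ) ^ ε⌋₊ :=
    hT_div ▸ primesIntegral_two_le_sumInvPrimes hm0 (hm2.trans hmT.le)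
  have h_high : m.totient * primesIntegral m T x ≤
      48 * (Real.log ε⁻¹ + 2 * √(Real.log x / Real.log m)) := by
    refine (totient_mul_primesIntegral_le hm0 (hm2.trans hmT.le) hmT hmx).trans ?_
    rw [hT_div]
    gcongr
    exact log_log_sub_log_log_rpow_le hε (by linarith) (hmT.trans_le hmx)
  calc m.totient * primesIntegral m 2 T * primesIntegral m T x
      = primesIntegral m 2 T * (m.totient * primesIntegral m T x) := by ring
    _ ≤ sumInvPrimes m ⌊(m : ℝ) ^ ε⌋₊ *
        (48 * (Real.log ε⁻¹ + 2 * √(Real.log x / Real.log m))) :=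
        mul_le_mul h_low h_high
          (mul_nonneg (Nat.cast_nonneg _) (primesIntegral_nonneg m hmx)) (sumInvPrimes_nonneg _ _)
    _ = _ := by ring

theorem crossSum_eq_sum_Icc_two (ε x : ℝ) :
    crossSum ε x = ∑ m ∈ Icc 2 ⌊x ^ (1 - ε)⌋₊,
      m.totient * primesIntegral m 2 (m ^ (1 + ε)) * primesIntegral m (m ^ (1 + ε)) x := by
  refine (sum_subset (Icc_subset_Icc_left one_le_two) fun m hm hm' => ?_).symm
  obtain rfl : m = 1 := by
    simp only [mem_Icc] at hm hm'
    omega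
  change _ * primesIntegral 1 2 _ * _ = 0
  rw [primesIntegral_two_eq_zero 1 (by simp), mul_zero, zero_mul]

theorem rpow_one_add_le_of_mem_Icc (hε : -1 ≤ ε) (hx : 1 ≤ x) {a : ℕ}
    (hm : m ∈ Icc a ⌊x ^ (1 - ε)⌋₊) : (m : ℝ) ^ (1 + ε) ≤ x :=
  rpow_one_add_le_of_le_rpow_one_sub hε hx
    ((Nat.cast_le.2 (mem_Icc.1 hm).2).trans (Nat.floor_le (by positivity)))

theorem crossSum_nonneg (hε : -1 ≤ ε) (hx : 1 ≤ x) : 0 ≤ crossSum ε x :=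
  sum_nonneg fun m hm => mul_nonneg
    (mul_nonneg (Nat.cast_nonneg _) (primesIntegral_two_nonneg m _))
    (primesIntegral_nonneg m (rpow_one_add_le_of_mem_Icc hε hx hm))

theorem Icc_two_floor_rpow_subset (hε : 0 ≤ ε) (hx : 1 ≤ x) :
    Icc 2 ⌊x ^ (1 - ε)⌋₊ ⊆ Ico 2 (2 ^ (Nat.log 2 ⌊x⌋₊ + 1)) := by
  have h_rpow : x ^ (1 - ε) ≤ x := Real.rpow_le_self_of_one_le hx (by linarith)
  have h_lt : ⌊x⌋₊ < 2 ^ (Nat.log 2 ⌊x⌋₊ + 1) := Nat.lt_pow_succ_log_self one_lt_two _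
  exact fun m hm => mem_Ico.2 ⟨(mem_Icc.1 hm).1,
    ((mem_Icc.1 hm).2.trans (Nat.floor_le_floor h_rpow)).trans_lt h_lt⟩

theorem abs_crossSum_le (hε : 0 < ε) (hε1 : ε ≤ 1) (hx : 1 ≤ x) :
    |crossSum ε x| ≤ 9216 * ∑ j ∈ Icc 1 (Nat.log 2 ⌊x⌋₊),
      (ε + (j : ℝ)⁻¹) * (Real.log ε⁻¹ + 4 * √(Real.log x) * (√j)⁻¹) := by
  have hL : 0 ≤ Real.log ε⁻¹ := Real.log_nonneg ((one_le_inv₀ hε).2 hε1)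
  let g (m : ℕ) : ℝ :=
    sumInvPrimes m ⌊(m : ℝ) ^ ε⌋₊ * (Real.log ε⁻¹ + 2 * √(Real.log x / Real.log m))
  have hg (m : ℕ) : 0 ≤ g m := mul_nonneg (sumInvPrimes_nonneg _ _) (by positivity)
  rw [abs_of_nonneg (crossSum_nonneg (by linarith) hx), crossSum_eq_sum_Icc_two]
  calc _ ≤ ∑ m ∈ Icc 2 ⌊x ^ (1 - ε)⌋₊, 48 * g m :=
        sum_le_sum fun m hm => totient_mul_primesIntegral_mul_le hε (mem_Icc.1 hm).1
          (rpow_one_add_le_of_mem_Icc (by linarith) hx hm)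
    _ ≤ 48 * ∑ m ∈ Ico 2 (2 ^ (Nat.log 2 ⌊x⌋₊ + 1)), g m := by
        rw [← mul_sum]
        gcongr
        · exact fun m _ _ => hg m
        · exact Icc_two_floor_rpow_subset hε.le hx
    _ ≤ 48 * (192 * ∑ j ∈ Icc 1 (Nat.log 2 ⌊x⌋₊),
          (ε + (j : ℝ)⁻¹) * (Real.log ε⁻¹ + 4 * √(Real.log x) * (√j)⁻¹)) := by
        gcongr
        exact sum_Ico_two_mul_sqrt_le hε.le hL (Real.log_nonneg hx) _
    _ = _ := by ring

end CrossSum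

/-! ### Summation over the dyadic blocks -/

section Asymptotics

theorem sum_inv_sqrt_le (J : ℕ) : ∑ j ∈ Icc 1 J, (√j)⁻¹ ≤ 2 * √J := by
  induction J with
  | zero => simp
  | succ J ih =>
    rw [sum_Icc_succ_top (by omega)]
    push_cast
    have h_sq : √(J : ℝ) ^ 2 = J := Real.sq_sqrt (by positivity)
    have h_sq_succ : √((J : ℝ) + 1) ^ 2 = J + 1 := Real.sq_sqrt (by positivity)
    have h_step : (√((J : ℝ) + 1))⁻¹ ≤ 2 * (√((J : ℝ) + 1) - √J) := by
      rw [inv_le_iff_one_le_mul₀ (by positivity)]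
      nlinarith [sq_nonneg (√((J : ℝ) + 1) - √J)]
    linarith

theorem sum_mul_add_mul_inv_sqrt_le {ε L b : ℝ} (hε : 0 ≤ ε) (hL : 0 ≤ L) (hb : 0 ≤ b) (J : ℕ) :
    ∑ j ∈ Icc 1 J, (ε + (j : ℝ)⁻¹) * (L + b * (√j)⁻¹) ≤
      ε * L * J + 2 * ε * b * √J + (L + b) * (1 + Real.log J) := by
  calc ∑ j ∈ Icc 1 J, (ε + (j : ℝ)⁻¹) * (L + b * (√j)⁻¹)
    _ ≤ ∑ j ∈ Icc 1 J, (ε * L + ε * b * (√j)⁻¹ + (L + b) * (j : ℝ)⁻¹) := by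
        refine sum_le_sum fun j hj => ?_
        have h_inv_sqrt : (√j)⁻¹ ≤ 1 :=
          inv_le_one_of_one_le₀ (Real.one_le_sqrt.2 (by exact_mod_cast (mem_Icc.1 hj).1))
        have : b * (j : ℝ)⁻¹ * (√j)⁻¹ ≤ b * (j : ℝ)⁻¹ :=
          mul_le_of_le_one_right (by positivity) h_inv_sqrt
        linarith
    _ = ε * L * J + ε * b * ∑ j ∈ Icc 1 J, (√j)⁻¹ + (L + b) * ∑ j ∈ Icc 1 J, (j : ℝ)⁻¹ := by
        simp only [sum_add_distrib, mul_sum, sum_const, Nat.card_Icc, Nat.add_sub_cancel,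
          nsmul_eq_mul]
        ring
    _ ≤ ε * L * J + ε * b * (2 * √J) + (L + b) * (1 + Real.log J) := by
        gcongr
        · exact sum_inv_sqrt_le J
        · exact sum_inv_le_one_add_log J
    _ = _ := by ring

theorem natLog_two_floor_le {x : ℝ} (hx : 1 ≤ x) : (Nat.log 2 ⌊x⌋₊ : ℝ) ≤ 2 * Real.log x := by
  have h_pow : 2 ^ Nat.log 2 ⌊x⌋₊ ≤ ⌊x⌋₊ := Nat.pow_log_le_self 2 (Nat.floor_pos.2 hx).ne'
  have h_half := half_mul_le_log h_pow
  have h_log : Real.log ⌊x⌋₊ ≤ Real.log x :=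
    Real.log_le_log (Nat.cast_pos.2 (Nat.floor_pos.2 hx)) (Nat.floor_le (by linarith))
  linarith

open Asymptotics Filter in
theorem isLittleO_add_sqrt_mul_one_add_log (L : ℝ) :
    (fun X : ℝ => (L + 4 * √X) * (1 + Real.log (2 * X))) =o[atTop] fun X => X := by
  have h_const_sqrt (c : ℝ) : (fun _ : ℝ => c) =o[atTop] Real.sqrt :=
    isLittleO_const_left.2 (Or.inr (tendsto_norm_atTop_atTop.comp Real.tendsto_sqrt_atTop))
  have h_left : (fun X : ℝ => L + 4 * √X) =O[atTop] Real.sqrt :=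
    (h_const_sqrt L).isBigO.add (isBigO_const_mul_self 4 _ _)
  have h_log : Real.log =o[atTop] Real.sqrt :=
    (isLittleO_log_rpow_atTop one_half_pos).congr_right fun X => (Real.sqrt_eq_rpow X).symm
  have h_right : (fun X : ℝ => 1 + Real.log (2 * X)) =o[atTop] Real.sqrt := by
    refine ((h_const_sqrt (1 + Real.log 2)).add h_log).congr' ?_ .rfl
    filter_upwards [eventually_gt_atTop 0] with X hX
    rw [Real.log_mul two_ne_zero hX.ne', add_assoc]
  refine (h_left.mul_isLittleO h_right).congr' .rfl ?_
  filter_upwards [eventually_ge_atTop 0] with X hX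
  exact Real.mul_self_sqrt hX

theorem sum_dyadic_le_of_add_sqrt_mul_le {ε L X : ℝ} (hε : 0 ≤ ε) (hL : 0 ≤ L) (hX : 1 ≤ X)
    (h_small : (L + 4 * √X) * (1 + Real.log (2 * X)) ≤ ε * X) {J : ℕ} (hJ : J ≤ 2 * X) :
    ∑ j ∈ Icc 1 J, (ε + (j : ℝ)⁻¹) * (L + 4 * √X * (√j)⁻¹) ≤ 17 * (ε * (1 + L) * X) := by
  have h_sqrt : √X * √J ≤ 2 * X := by
    rw [← Real.sqrt_mul (by linarith), Real.sqrt_le_left (by linarith)]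
    nlinarith
  have h_log : Real.log J ≤ Real.log (2 * X) := by
    rcases J.eq_zero_or_pos with rfl | hJ0
    · simpa using Real.log_nonneg (by linarith : 1 ≤ 2 * X)
    · exact Real.log_le_log (Nat.cast_pos.2 hJ0) hJ
  have h_lower_order : (L + 4 * √X) * (1 + Real.log J) ≤ ε * X := by
    refine le_trans ?_ h_small
    gcongr
  calc _ ≤ ε * L * J + 2 * ε * (4 * √X) * √J + (L + 4 * √X) * (1 + Real.log J) :=
        sum_mul_add_mul_inv_sqrt_le hε hL (by positivity) J
    _ = ε * L * J + 8 * ε * (√X * √J) + (L + 4 * √X) * (1 + Real.log J) := by ring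
    _ ≤ ε * L * (2 * X) + 8 * ε * (2 * X) + ε * X := by
        gcongr ?_ + _ * ?_ + ?_
        gcongr
    _ ≤ 17 * (ε * (1 + L) * X) := by
        have : 0 ≤ ε * L * X := by positivity
        linarith

end Asymptotics

theorem proposition3_general :
    ∃ C : ℝ, 0 < C ∧ ∀ ε : ℝ, 0 < ε → ε < 1 → ∃ x₀ : ℝ, ∀ x : ℝ, x₀ ≤ x →
      |crossSum ε x| ≤ C * (ε * (1 + Real.log ε⁻¹) * Real.log x) := by
  refine ⟨9216 * 17, by norm_num, fun ε hε hε1 => ?_⟩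
  have hL : 0 ≤ Real.log ε⁻¹ := Real.log_nonneg ((one_le_inv₀ hε).2 hε1.le)
  have h_small : ∀ᶠ X in Filter.atTop, 1 ≤ X ∧
      (Real.log ε⁻¹ + 4 * √X) * (1 + Real.log (2 * X)) ≤ ε * X := by
    filter_upwards [Filter.eventually_ge_atTop 1,
      (isLittleO_add_sqrt_mul_one_add_log (Real.log ε⁻¹)).bound hε] with X hX h
    rw [Real.norm_of_nonneg (zero_le_one.trans hX)] at h
    exact ⟨hX, (Real.le_norm_self _).trans h⟩
  obtain ⟨x₀, hx₀⟩ := Filter.eventually_atTop.1 <|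
    (Filter.eventually_ge_atTop 1).and (Real.tendsto_log_atTop.eventually h_small)
  refine ⟨x₀, fun x hx => ?_⟩
  obtain ⟨hx1, hX, h_lower_order⟩ := hx₀ x hx
  rw [mul_assoc 9216]
  refine (abs_crossSum_le hε hε1.le hx1).trans ?_
  gcongr
  exact sum_dyadic_le_of_add_sqrt_mul_le hε.le hL hX h_lower_order (natLog_two_floor_le hx1)

theorem one_add_log_inv_le {ε : ℝ} (hε : 0 < ε) (hε_lt : ε < Real.exp (-1)) :
    1 + Real.log ε⁻¹ ≤ 2 * Real.log ε⁻¹ ^ 2 := by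
  have hL : 1 ≤ Real.log ε⁻¹ := by
    rw [Real.log_inv, le_neg, Real.log_le_iff_le_exp hε]
    exact hε_lt.le
  nlinarith

theorem proposition3 :
    ∃ C : ℝ, 0 < C ∧ ∃ ε₀ : ℝ, 0 < ε₀ ∧ ε₀ < 1 ∧
      ∀ ε : ℝ, 0 < ε → ε < ε₀ →
        ∃ x₀ : ℝ, ∀ x : ℝ, x₀ ≤ x →
          |crossSum ε x| ≤
            C * (ε * (Real.log ε⁻¹) ^ 2 * Real.log x + (Real.log (Real.log x)) ^ 2) := by
  obtain ⟨C, hC, h_bound⟩ := proposition3_general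
  have h_exp : Real.exp (-1) < 1 := Real.exp_lt_one_iff.2 (by norm_num)
  refine ⟨2 * C, by positivity, Real.exp (-1), Real.exp_pos _, h_exp, fun ε hε hε_lt => ?_⟩
  obtain ⟨x₀, hx₀⟩ := h_bound ε hε (hε_lt.trans h_exp)
  refine ⟨max x₀ 1, fun x hx => (hx₀ x (le_of_max_le_left hx)).trans ?_⟩
  have hX : 0 ≤ Real.log x := Real.log_nonneg (le_of_max_le_right hx)
  calc C * (ε * (1 + Real.log ε⁻¹) * Real.log x)
    _ ≤ C * (ε * (2 * Real.log ε⁻¹ ^ 2) * Real.log x) := by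
        gcongr
        exact one_add_log_inv_le hε hε_lt
    _ = 2 * C * (ε * Real.log ε⁻¹ ^ 2 * Real.log x) := by ring
    _ ≤ _ := by gcongr; exact le_add_of_nonneg_right (sq_nonneg _)
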